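/- Let $K$ be an algebraically closed field of characteristic $0$, and equip $\mathbb{A}^n=K^n$ with the Zariski topology. Let $V\subseteq\mathbb{A}^n$ be an irreducible algebraic variety (a nonempty irreducible Zariski closed subset) and let $I(V)\subseteq K[x_1,\dots,x_n]$ be the ideal of all polynomials vanishing on $V$. Let $\operatorname{Reg}(V)$ be the set of points $p\in V$ whose local ring $\mathcal{O}_{V,p}$ is regular, and for $p\in V$ let \[ T_pV=\{\,y\in K^n \;:\; \nabla f(p)\cdot y=0 \text{ for all } f\in I(V)\,\}. \] Suppose that there exists a nonempty Zariski open subset $\mathcal{U}$ of $V$ with $\mathcal{U}\subseteq\operatorname{Reg}(V)$ such that $T_pV=T_qV$ (as linear subspaces of $K^n$) for all $p,q\in\mathcal{U}$. Then $V$ is a linear variety, that is, an affine linear subspace of $K^n$ (not necessarily passing through the origin). -/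

import Mathlib

namespace TangentLinear

open MvPolynomial Topology

theorem zeroLocus_union {K : Type*} [Field K] {n : ℕ} (I J : Ideal (MvPolynomial (Fin n) K)) :
    zeroLocus K I ∪ zeroLocus K J = zeroLocus K (I * J) := by
  refine Set.Subset.antisymm
    (Set.union_subset (zeroLocus_anti_mono Ideal.mul_le_left)
      (zeroLocus_anti_mono Ideal.mul_le_right)) ?_
  intro x hx
  by_contra hcon
  rw [Set.mem_union, not_or] at hcon
  obtain ⟨h1, h2⟩ := hcon
  rw [mem_zeroLocus_iff] at h1 h2
  push Not at h1 h2
  obtain ⟨f, hf, hf0⟩ := h1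
  obtain ⟨g, hg, hg0⟩ := h2
  have h3 : aeval x (f * g) = 0 := (mem_zeroLocus_iff.1 hx) _ (Ideal.mul_mem_mul hf hg)
  rw [map_mul] at h3
  exact (mul_ne_zero hf0 hg0) h3

theorem zeroLocus_sInter {K : Type*} [Field K] {n : ℕ} (A : Set (Set (Fin n → K)))
    (hA : ∀ Z ∈ A, ∃ I : Ideal (MvPolynomial (Fin n) K), Z = zeroLocus K I) :
    ⋂₀ A = zeroLocus K (vanishingIdeal K (⋂₀ A)) := by
  refine Set.Subset.antisymm (zeroLocus_vanishingIdeal_le _) ?_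
  intro x hx Z hZ
  obtain ⟨I, rfl⟩ := hA Z hZ
  rw [mem_zeroLocus_iff]
  intro p hp
  refine (mem_zeroLocus_iff.1 hx) p ?_
  rw [mem_vanishingIdeal_iff]
  intro y hy
  exact (mem_zeroLocus_iff.1 (Set.mem_sInter.1 hy _ hZ)) p hp

/-- The Zariski topology on affine space `K^n`: the closed sets are the common zero loci of
ideals of polynomials (equivalently, of arbitrary sets of polynomials). -/
abbrev zariski (K : Type*) [Field K] (n : ℕ) : TopologicalSpace (Fin n → K) :=
  TopologicalSpace.ofClosed
    {Z | ∃ I : Ideal (MvPolynomial (Fin n) K), Z = zeroLocus K I}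
    ⟨⊤, by simp⟩
    (fun A hA => ⟨_, zeroLocus_sInter A fun _ hZ => hA hZ⟩)
    (by
      rintro _ ⟨I, rfl⟩ _ ⟨J, rfl⟩
      exact ⟨I * J, zeroLocus_union I J⟩)

theorem isClosed_zariski_iff {K : Type*} [Field K] {n : ℕ} {Z : Set (Fin n → K)} :
    IsClosed[zariski K n] Z ↔ ∃ I : Ideal (MvPolynomial (Fin n) K), Z = zeroLocus K I := by
  rw [← @isOpen_compl_iff _ _ (zariski K n)]
  change Zᶜᶜ ∈ {Z | ∃ I : Ideal (MvPolynomial (Fin n) K), Z = zeroLocus K I} ↔ _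
  rw [compl_compl]
  rfl

variable {K : Type*} [Field K] {n : ℕ}

/-- An irreducible affine algebraic variety in `K^n`: a Zariski closed set which is irreducible
(in particular nonempty) for the Zariski topology. -/
def IsIrreducibleVariety (V : Set (Fin n → K)) : Prop :=
  IsClosed[zariski K n] V ∧ @IsIrreducible (Fin n → K) (zariski K n) V

/-- `U` is a Zariski open subset of `V`, i.e. open in the subspace topology of `V`. -/
def IsZariskiOpenIn (V U : Set (Fin n → K)) : Prop :=
  ∃ O : Set (Fin n → K), IsOpen[zariski K n] O ∧ U = V ∩ O

/-- The coordinate ring `K[V] = K[x₁, …, xₙ] / I(V)`. -/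
abbrev CoordinateRing (V : Set (Fin n → K)) : Type _ :=
  MvPolynomial (Fin n) K ⧸ vanishingIdeal K V

/-- Evaluation of a regular function on `V` at a point of `V`. -/
noncomputable def evalAt (V : Set (Fin n → K)) (p : V) : CoordinateRing V →+* K :=
  Ideal.Quotient.lift (vanishingIdeal K V) (aeval (p : Fin n → K)).toRingHom
    (fun _ hf => hf p p.2)

/-- The (maximal) ideal of `K[V]` of the regular functions vanishing at `p`. -/
noncomputable def pointIdeal (V : Set (Fin n → K)) (p : V) : Ideal (CoordinateRing V) :=
  RingHom.ker (evalAt V p)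

instance pointIdeal_isPrime (V : Set (Fin n → K)) (p : V) : (pointIdeal V p).IsPrime :=
  RingHom.ker_isPrime (evalAt V p)

/-- The local ring of `V` at the point `p`. -/
abbrev LocalRingAt (V : Set (Fin n → K)) (p : V) : Type _ :=
  Localization.AtPrime (pointIdeal V p)

/-- `Reg(V)`: the points `p` of `V` at which `V` is smooth, i.e. whose local ring is regular. -/
def Reg (V : Set (Fin n → K)) : Set (Fin n → K) :=
  {p | ∃ hp : p ∈ V, IsRegularLocalRing (LocalRingAt V ⟨p, hp⟩)}

/-- The tangent space `T_p V` as a linear subspace of `K^n`: the vectors `y` with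
`∇f(p) · y = 0` for all `f ∈ I(V)`. -/
def tangentSpace (V : Set (Fin n → K)) (p : Fin n → K) : Submodule K (Fin n → K) where
  carrier := {y | ∀ f ∈ vanishingIdeal K V, ∑ i, aeval p (pderiv i f) * y i = 0}
  zero_mem' := by simp
  add_mem' := by
    intro a b ha hb f hf
    simp only [Pi.add_apply, mul_add, Finset.sum_add_distrib, ha f hf, hb f hf, add_zero]
  smul_mem' := by
    intro c a ha f hf
    simp only [Pi.smul_apply, smul_eq_mul, mul_left_comm _ c, ← Finset.mul_sum, ha f hf, mul_zero]

/-- At a point of `V` it suffices to test the gradients of a system of generators of `I(V)`. -/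
theorem mem_tangentSpace_iff {V : Set (Fin n → K)} {p : Fin n → K} (hp : p ∈ V)
    {F : Set (MvPolynomial (Fin n) K)} (hF : Ideal.span F = vanishingIdeal K V)
    (y : Fin n → K) :
    y ∈ tangentSpace V p ↔ ∀ f ∈ F, ∑ i, aeval p (pderiv i f) * y i = 0 := by
  constructor
  · intro h f hf
    exact h f (hF ▸ Ideal.subset_span hf)
  · intro h f hf
    rw [← hF] at hf
    induction hf using Submodule.span_induction with
    | mem f hf => exact h f hf
    | zero => simp
    | add f g _ _ hf hg => simp only [map_add, add_mul, Finset.sum_add_distrib, hf, hg, add_zero]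
    | smul a f hfm hf =>
      have h0 : aeval p f = 0 := by
        have : f ∈ vanishingIdeal K V := hF ▸ hfm
        exact this p hp
      simp only [smul_eq_mul, Derivation.leibniz, map_add, map_mul, h0, zero_mul,
        add_zero, mul_assoc, ← Finset.mul_sum, hf, mul_zero]

/-- A linear variety in affine space `K^n`: an affine subspace (not necessarily through `0`). -/
def IsLinearVariety (V : Set (Fin n → K)) : Prop :=
  ∃ L : AffineSubspace K (Fin n → K), (L : Set (Fin n → K)) = V

end TangentLinear

namespace TangentLinear

open MvPolynomial Topology

/-! Let `T` be the common tangent space on `U` and fix `p ∈ U`; then `V = p + T`.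

`p + T ⊆ V`: for `y ∈ T` and `f ∈ I(V)`, the derivative of `f` along `y` vanishes on the dense set
`U`, hence lies in `I(V)`. So all iterated derivatives vanish at `p`, and Taylor's formula in
characteristic zero gives `f (p + y) = 0` (`add_mem_of_forall_mem_tangentSpace`).

`V ⊆ p + T`: it suffices that each linear form `φ` killing `T` is constant on `V`
(`linearMap_eq_of_forall_mem_tangentSpace`). If `φ` were transcendental in `K(V)`, some derivation
of `K(V)` would not kill it. Cleared of denominators, this is a polynomial vector field tangent to
`V`, with values in `T` on `U`, so it does kill `φ`. Hence `φ` is algebraic over `K`, so constant.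
-/

/-- A transcendental element of a finitely generated field extension in characteristic zero can be
lifted freely along nilpotent thickenings. -/
theorem exists_section_of_transcendental {K L B : Type*} [Field K] [CharZero K] [Field L]
    [Algebra K L] [Algebra.EssFiniteType K L] [CommRing B] [Algebra K B] {t : L}
    (ht : Transcendental K t) (g : B →ₐ[K] L) (hg : Function.Surjective g)
    (hker : IsNilpotent (RingHom.ker (g : B →+* L))) {b : B} (hb : g b = t) :
    ∃ s : L →ₐ[K] B, s t = b ∧ ∀ x, g (s x) = x := by
  -- Let `X` act as `t` on `L` and as `b` on `B`: a section linear over `K[X]` must send `t` to `b`.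
  let : Algebra (Polynomial K) L := (Polynomial.aeval t).toAlgebra
  let : Algebra (Polynomial K) B := (Polynomial.aeval b).toAlgebra
  have hL (q : Polynomial K) : algebraMap (Polynomial K) L q = Polynomial.aeval t q := rfl
  have hB (q : Polynomial K) : algebraMap (Polynomial K) B q = Polynomial.aeval b q := rfl
  have : IsScalarTower K (Polynomial K) L := .of_algebraMap_eq fun x => by
    rw [hL, Polynomial.algebraMap_eq, Polynomial.aeval_C]
  have : IsScalarTower K (Polynomial K) B := .of_algebraMap_eq fun x => by
    rw [hB, Polynomial.algebraMap_eq, Polynomial.aeval_C]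
  have : FaithfulSMul (Polynomial K) L :=
    (faithfulSMul_iff_algebraMap_injective _ _).2 (transcendental_iff_injective.1 ht)
  let := FractionRing.liftAlgebra (Polynomial K) L
  have := FractionRing.isScalarTower_liftAlgebra (Polynomial K) L
  have : IsScalarTower K (FractionRing (Polynomial K)) L := .to₁₃₄ K (Polynomial K) _ L
  have : CharZero (FractionRing (Polynomial K)) :=
    charZero_of_injective_algebraMap (algebraMap K _).injective
  have : Algebra.EssFiniteType (FractionRing (Polynomial K)) L := .of_comp K _ L
  -- `K[X] → K(X)` is a localization, and `L` is a finitely generated extension of the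
  -- characteristic zero field `K(X)`; both are formally smooth.
  have : Algebra.FormallySmooth (Polynomial K) (FractionRing (Polynomial K)) :=
    .of_isLocalization (nonZeroDivisors _)
  have : Algebra.FormallySmooth (Polynomial K) L :=
    .comp _ (FractionRing (Polynomial K)) _
  let g' : B →ₐ[Polynomial K] L :=
    { (g : B →+* L) with
      commutes' := fun q => by
        change g (Polynomial.aeval b q) = Polynomial.aeval t q
        rw [← hb, Polynomial.aeval_algHom_apply] }
  let s := Algebra.FormallySmooth.liftOfSurjective (AlgHom.id (Polynomial K) L) g' hg hker
  refine ⟨s.restrictScalars K, ?_,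
    Algebra.FormallySmooth.liftOfSurjective_apply (AlgHom.id (Polynomial K) L) g' hg hker⟩
  simpa [hL, hB] using s.commutes Polynomial.X

theorem isNilpotent_ideal_of_mul_eq_zero {R : Type*} [CommRing R] (I : Ideal R)
    (h : ∀ a ∈ I, ∀ b ∈ I, a * b = 0) : IsNilpotent I :=
  ⟨2, by rw [pow_two, Ideal.zero_eq_bot, eq_bot_iff, Ideal.mul_le]; exact h⟩

/-- In characteristic zero some derivation of a finitely generated field extension does not kill a
given transcendental element. -/
theorem exists_derivation_ne_zero_of_transcendental {K L : Type*} [Field K] [CharZero K] [Field L]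
    [Algebra K L] [Algebra.EssFiniteType K L] {t : L} (ht : Transcendental K t) :
    ∃ D : Derivation K L L, D t ≠ 0 := by
  -- A section `x ↦ x + D x · ε` of `L[ε] → L` amounts to a derivation `D`; lifting `t` to `t + ε`
  -- forces `D t = 1`.
  let g : DualNumber L →ₐ[K] L := TrivSqZeroExt.fstHom K L L
  have hker : IsNilpotent (RingHom.ker (g : DualNumber L →+* L)) := by
    refine isNilpotent_ideal_of_mul_eq_zero _ fun a ha b hb => ?_
    have ha' : a.fst = 0 := ha
    have hb' : b.fst = 0 := hb
    ext <;> simp [ha', hb']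
  obtain ⟨s, hst, hs⟩ := exists_section_of_transcendental ht g
    (fun x => ⟨TrivSqZeroExt.inl x, rfl⟩) hker
    (b := TrivSqZeroExt.inl t + TrivSqZeroExt.inr 1) (by simp [g])
  have hs' (x : L) : (s x).fst = x := hs x
  refine ⟨Derivation.mk' ((TrivSqZeroExt.sndHom L L).restrictScalars K ∘ₗ s.toLinearMap) ?_, ?_⟩
  · intro a b
    simp [hs', mul_comm]
  · simp [hst]

/-- A function on an irreducible scheme which is killed by all polynomial vector fields tangent to
it is constant. -/
theorem exists_sub_C_mem_of_forall_mkDerivation_mem {K σ : Type*} [Finite σ] [Field K]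
    [IsAlgClosed K] [CharZero K] (P : Ideal (MvPolynomial σ K)) [P.IsPrime] (l : MvPolynomial σ K)
    (h : ∀ Y : σ → MvPolynomial σ K, (∀ f ∈ P, mkDerivation K Y f ∈ P) → mkDerivation K Y l ∈ P) :
    ∃ c : K, l - C c ∈ P := by
  let R := MvPolynomial σ K ⧸ P
  let L := FractionRing R
  let π : MvPolynomial σ K →ₐ[K] L := (Algebra.ofId R L).restrictScalars K |>.comp
    (Ideal.Quotient.mkₐ K P)
  have hπ (f : MvPolynomial σ K) : π f = 0 ↔ f ∈ P := by
    change algebraMap R L (Ideal.Quotient.mk P f) = 0 ↔ _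
    rw [FaithfulSMul.algebraMap_eq_zero_iff, Ideal.Quotient.eq_zero_iff_mem]
  have : Algebra.EssFiniteType K L := Algebra.EssFiniteType.comp K R L
  by_cases ht : Transcendental K (π l)
  · exfalso
    obtain ⟨D, hD⟩ := exists_derivation_ne_zero_of_transcendental ht
    -- A common denominator `b` of the `D xᵢ` makes `b • D` come from a polynomial vector field `Y`,
    -- which preserves `P = ker π`.
    obtain ⟨b, hb⟩ := IsLocalization.exist_integer_multiples_of_finite (nonZeroDivisors R)
      (fun i => D (π (X i)))
    choose y hy using hb
    choose Y hY using fun i => Ideal.Quotient.mk_surjective (y i)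
    have key (f : MvPolynomial σ K) : π (mkDerivation K Y f) = algebraMap R L b * D (π f) := by
      induction f using MvPolynomial.induction_on with
      | C a =>
        have : π (C a) = algebraMap K L a := π.commutes a
        simp [this, derivation_C]
      | add p q hp hq => simp only [map_add, hp, hq, mul_add]
      | mul_X p i hp =>
        have : π (Y i) = algebraMap R L b * D (π (X i)) := by
          change algebraMap R L (Ideal.Quotient.mk P (Y i)) = _
          rw [hY, hy, Algebra.smul_def]
        simp only [Derivation.leibniz, map_add, map_mul, smul_eq_mul, mkDerivation_X, hp, this]
        ring
    have hl := (hπ _).2 (h Y fun f hf => by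
      rw [← hπ, key, (hπ f).2 hf, map_zero, mul_zero])
    rw [key, mul_eq_zero, or_iff_left hD, FaithfulSMul.algebraMap_eq_zero_iff] at hl
    exact nonZeroDivisors.coe_ne_zero b hl
  · obtain ⟨c, hc⟩ := minpoly.mem_range_of_degree_eq_one K (π l)
      (IsAlgClosed.degree_eq_one_of_irreducible K
        (minpoly.irreducible (IsAlgebraic.isIntegral (not_not.1 ht))))
    refine ⟨c, ?_⟩
    rw [← hπ, map_sub, ← hc]
    exact sub_eq_zero.2 (π.commutes c).symm

/-! ### Taylor expansion on a line -/

/-- Taylor expansion along a direction: a polynomial all of whose iterated directional derivatives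
vanish at `p` vanishes on the line through `p`. -/
theorem aeval_add_eq_zero_of_iterate_mkDerivation {K σ : Type*} [Field K] [CharZero K]
    (p y : σ → K) (f : MvPolynomial σ K)
    (h : ∀ k, aeval p ((mkDerivation K fun i => (C (y i) : MvPolynomial σ K))^[k] f) = 0) :
    aeval (p + y) f = 0 := by
  let D := mkDerivation K fun i => (C (y i) : MvPolynomial σ K)
  -- Restriction to the line `p + X y`, which turns `D` into `d/dX`.
  let φ : MvPolynomial σ K →ₐ[K] Polynomial K :=
    aeval fun i => Polynomial.C (p i) + Polynomial.C (y i) * Polynomial.X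
  have hφ (g : MvPolynomial σ K) : Polynomial.derivative (φ g) = φ (D g) := by
    induction g using MvPolynomial.induction_on with
    | C a => simp [φ, D, derivation_C]
    | add g₁ g₂ h₁ h₂ => simp only [map_add, h₁, h₂]
    | mul_X g i hg =>
      have h1 : φ (X i) = Polynomial.C (p i) + Polynomial.C (y i) * Polynomial.X := aeval_X _ _
      have h2 : φ (C (y i)) = Polynomial.C (y i) := aeval_C _ _
      simp only [map_mul, Polynomial.derivative_mul, hg, Derivation.leibniz, map_add, smul_eq_mul,
        h1, D, mkDerivation_X, h2]
      simp
      ring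
  have heval (c : K) (g : MvPolynomial σ K) : (φ g).eval c = aeval (p + c • y) g := by
    rw [← Polynomial.coe_aeval_eq_eval, ← AlgHom.comp_apply]
    refine DFunLike.congr_fun (MvPolynomial.algHom_ext fun i => ?_) g
    rw [AlgHom.comp_apply, aeval_X, aeval_X, Polynomial.coe_aeval_eq_eval]
    simp only [Polynomial.eval_add, Polynomial.eval_mul, Polynomial.eval_C, Polynomial.eval_X,
      Pi.add_apply, Pi.smul_apply, smul_eq_mul, mul_comm]
  have hiter (k : ℕ) : Polynomial.derivative^[k] (φ f) = φ (D^[k] f) := by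
    induction k with
    | zero => rfl
    | succ k ih => rw [Function.iterate_succ_apply', Function.iterate_succ_apply', ih, hφ]
  have h0 : φ f = 0 := by
    ext k
    -- The `k`-th derivative at `0` is `k!` times the `k`-th coefficient, and `k! ≠ 0` in `K`.
    have := Polynomial.coeff_iterate_derivative (k := k) (φ f) 0
    rw [hiter, Polynomial.coeff_zero_eq_eval_zero, heval, zero_smul, add_zero, h k, zero_add,
      Nat.descFactorial_self, eq_comm, smul_eq_zero] at this
    simpa using this.resolve_left (Nat.factorial_ne_zero k)
  have := heval 1 f
  rwa [h0, Polynomial.eval_zero, one_smul, eq_comm] at this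

/-! ### Density of open subsets and the two inclusions -/

variable {K : Type*} [Field K] {n : ℕ}

theorem aeval_mkDerivation (p : Fin n → K) (Y : Fin n → MvPolynomial (Fin n) K)
    (f : MvPolynomial (Fin n) K) :
    aeval p (mkDerivation K Y f) = ∑ i, aeval p (pderiv i f) * aeval p (Y i) := by
  induction f using MvPolynomial.induction_on with
  | C a => simp [derivation_C]
  | add g₁ g₂ h₁ h₂ => simp only [map_add, h₁, h₂, add_mul, Finset.sum_add_distrib]
  | mul_X g j hg =>
    simp only [Derivation.leibniz, smul_eq_mul, mkDerivation_X, map_add, map_mul, hg, add_mul,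
      Finset.sum_add_distrib, Finset.mul_sum, pderiv_X, mul_assoc]
    congr 1
    rw [Finset.sum_eq_single j (fun i _ hij => by simp [hij.symm]) (by simp)]
    simp

theorem isClosed_zeroLocus (I : Ideal (MvPolynomial (Fin n) K)) :
    IsClosed[zariski K n] (zeroLocus K I) :=
  isClosed_zariski_iff.2 ⟨I, rfl⟩

theorem zeroLocus_vanishingIdeal_of_isClosed {V : Set (Fin n → K)} (hV : IsClosed[zariski K n] V) :
    zeroLocus K (vanishingIdeal K V) = V := by
  obtain ⟨I, rfl⟩ := isClosed_zariski_iff.1 hV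
  exact (zeroLocus_vanishingIdeal_galoisConnection (k := K) (K := K)).l_u_l_eq_l I

theorem subset_or_subset_of_isIrreducible {V A B : Set (Fin n → K)}
    (hV : @IsIrreducible (Fin n → K) (zariski K n) V) (hA : IsClosed[zariski K n] A)
    (hB : IsClosed[zariski K n] B) (h : V ⊆ A ∪ B) : V ⊆ A ∨ V ⊆ B := by
  let := zariski K n
  exact isPreirreducible_iff_isClosed_union_isClosed.1 hV.2 A B hA hB h

theorem subset_zeroLocus_span_singleton {V : Set (Fin n → K)} {f : MvPolynomial (Fin n) K} :
    V ⊆ zeroLocus K (Ideal.span {f}) ↔ f ∈ vanishingIdeal K V := by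
  rw [le_zeroLocus_iff_le_vanishingIdeal, Ideal.span_singleton_le_iff_mem]

theorem vanishingIdeal_isPrime {V : Set (Fin n → K)}
    (hV : @IsIrreducible (Fin n → K) (zariski K n) V) :
    (vanishingIdeal K V : Ideal (MvPolynomial (Fin n) K)).IsPrime := by
  refine ⟨fun htop => ?_, fun {f g} hfg => ?_⟩
  · obtain ⟨x, hx⟩ := hV.1
    have : (1 : MvPolynomial (Fin n) K) ∈ vanishingIdeal K V := htop ▸ Submodule.mem_top
    simpa using this x hx
  · rw [← subset_zeroLocus_span_singleton, ← subset_zeroLocus_span_singleton]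
    refine subset_or_subset_of_isIrreducible hV (isClosed_zeroLocus _) (isClosed_zeroLocus _) ?_
    rwa [zeroLocus_union, Ideal.span_singleton_mul_span_singleton, subset_zeroLocus_span_singleton]

/-- A polynomial vanishing on a nonempty open subset of an irreducible variety vanishes on it. -/
theorem mem_vanishingIdeal_of_isZariskiOpenIn {V U : Set (Fin n → K)}
    (hV : @IsIrreducible (Fin n → K) (zariski K n) V) (hU : IsZariskiOpenIn V U)
    (hne : U.Nonempty) {f : MvPolynomial (Fin n) K} (hf : ∀ x ∈ U, aeval x f = 0) :
    f ∈ vanishingIdeal K V := by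
  obtain ⟨O, hO, rfl⟩ := hU
  have hOc : IsClosed[zariski K n] Oᶜ := (@isClosed_compl_iff _ (zariski K n) O).2 hO
  rw [← subset_zeroLocus_span_singleton]
  refine (subset_or_subset_of_isIrreducible hV hOc
    (isClosed_zeroLocus (Ideal.span {f})) fun x hx => ?_).resolve_left fun h => ?_
  · by_cases hxO : x ∈ O
    · exact Or.inr (subset_zeroLocus_span_singleton.2
        ((mem_vanishingIdeal_singleton_iff x f).2 (hf x ⟨hx, hxO⟩)) (Set.mem_singleton x))
    · exact Or.inl hxO
  · obtain ⟨x, hxV, hxO⟩ := hne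
    exact h hxV hxO

theorem aeval_sum_C_mul_X (φ : (Fin n → K) →ₗ[K] K) (q : Fin n → K) :
    aeval q (∑ i, C (φ (Pi.single i 1)) * X i : MvPolynomial (Fin n) K) = φ q := by
  conv_rhs => rw [LinearMap.pi_apply_eq_sum_univ φ q]
  simp only [map_sum, map_mul, aeval_C, aeval_X, Algebra.algebraMap_self, RingHom.id_apply,
    smul_eq_mul]
  refine Finset.sum_congr rfl fun i _ => ?_
  rw [mul_comm]
  congr 2
  ext j
  simp [Pi.single_apply, eq_comm]

/-- A variety whose generic tangent vectors `y` have vanishing `φ y`, for a linear form `φ`, lies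
in a level set of `φ`. -/
theorem linearMap_eq_of_forall_mem_tangentSpace [IsAlgClosed K] [CharZero K]
    {V U : Set (Fin n → K)} (hV : @IsIrreducible (Fin n → K) (zariski K n) V)
    (hU : IsZariskiOpenIn V U) (hne : U.Nonempty) (φ : (Fin n → K) →ₗ[K] K)
    (hφ : ∀ p ∈ U, ∀ y ∈ tangentSpace V p, φ y = 0) {p q : Fin n → K} (hp : p ∈ V) (hq : q ∈ V) :
    φ p = φ q := by
  have := vanishingIdeal_isPrime hV
  have hUV : U ⊆ V := by
    obtain ⟨O, -, rfl⟩ := hU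
    exact Set.inter_subset_left
  let l : MvPolynomial (Fin n) K := ∑ i, C (φ (Pi.single i 1)) * X i
  have hl (r : Fin n → K) : aeval r l = φ r := aeval_sum_C_mul_X φ r
  obtain ⟨c, hc⟩ := exists_sub_C_mem_of_forall_mkDerivation_mem (vanishingIdeal K V) l
    fun Y hY => mem_vanishingIdeal_of_isZariskiOpenIn hV hU hne fun r hr => by
      have hYr : (fun i => aeval r (Y i)) ∈ tangentSpace V r := fun f hf => by
        rw [← aeval_mkDerivation]
        exact hY f hf r (hUV hr)
      have hlY : mkDerivation K Y l = ∑ i, C (φ (Pi.single i 1)) * Y i := by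
        simp [l, Derivation.leibniz, derivation_C, mkDerivation_X]
      rw [hlY, ← hφ r hr _ hYr, ← aeval_sum_C_mul_X]
      simp
  have hconst (r : Fin n → K) (hr : r ∈ V) : φ r = c := by
    have := hc r hr
    rwa [map_sub, hl, aeval_C, Algebra.algebraMap_self, RingHom.id_apply, sub_eq_zero] at this
  rw [hconst p hp, hconst q hq]

/-- An irreducible variety is stable under translation by a vector which is tangent to it at all
points of a nonempty open subset. -/
theorem add_mem_of_forall_mem_tangentSpace [CharZero K] {V U : Set (Fin n → K)}
    (hV : IsIrreducibleVariety V) (hU : IsZariskiOpenIn V U) (hne : U.Nonempty) {y : Fin n → K}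
    (hy : ∀ p ∈ U, y ∈ tangentSpace V p) {p : Fin n → K} (hp : p ∈ V) : p + y ∈ V := by
  rw [← zeroLocus_vanishingIdeal_of_isClosed hV.1]
  intro f hf
  refine aeval_add_eq_zero_of_iterate_mkDerivation p y f fun k => ?_
  -- Membership in all of `I(V)`, not just vanishing at `p`, is what the induction can propagate.
  suffices (mkDerivation K fun i => (C (y i) : MvPolynomial (Fin n) K))^[k] f ∈
      vanishingIdeal K V from this p hp
  induction k with
  | zero => exact hf
  | succ k ih =>
    rw [Function.iterate_succ_apply']
    refine mem_vanishingIdeal_of_isZariskiOpenIn hV.2 hU hne fun r hr => ?_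
    rw [aeval_mkDerivation]
    simpa using hy r hr _ ih

end TangentLinear

theorem mainTheorem9 {K : Type*} [Field K] [IsAlgClosed K] [CharZero K] {n : ℕ}
    (V : Set (Fin n → K)) (hV : TangentLinear.IsIrreducibleVariety V)
    (h : ∃ U : Set (Fin n → K), TangentLinear.IsZariskiOpenIn V U ∧ U.Nonempty ∧
      U ⊆ TangentLinear.Reg V ∧
      ∀ p ∈ U, ∀ q ∈ U, TangentLinear.tangentSpace V p = TangentLinear.tangentSpace V q) :
    TangentLinear.IsLinearVariety V := by
  obtain ⟨U, hU, ⟨p, hp⟩, hreg, hT⟩ := h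
  have hpV : p ∈ V := (hreg hp).1
  refine ⟨AffineSubspace.mk' p (TangentLinear.tangentSpace V p), Set.Subset.antisymm ?_ ?_⟩
  · intro x hx
    rw [SetLike.mem_coe, AffineSubspace.mem_mk', vsub_eq_sub] at hx
    rw [← add_sub_cancel p x]
    exact TangentLinear.add_mem_of_forall_mem_tangentSpace hV hU ⟨p, hp⟩
      (fun q hq => hT p hp q hq ▸ hx) hpV
  · intro x hx
    rw [SetLike.mem_coe, AffineSubspace.mem_mk', vsub_eq_sub]
    by_contra hcon
    -- A linear form that kills `T` but not `x - p`.
    obtain ⟨φ, hφ, hle⟩ := Submodule.exists_le_ker_of_notMem hcon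
    refine hφ ?_
    rw [map_sub, sub_eq_zero]
    exact TangentLinear.linearMap_eq_of_forall_mem_tangentSpace hV.2 hU ⟨p, hp⟩ φ
      (fun q hq y hy => hle (hT p hp q hq ▸ hy)) hx hpV
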